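/- Let $(X,d,\mu)$ be a metric space with a Borel regular doubling measure $\mu$ such that $0<\mu(B)<\infty$ for all balls $B$. A ball $B=B(x_B,r_B)$ is an open ball that comes with a center and a radius $0<r_B<\infty$; for $\lambda>0$ let $\lambda B=B(x_B,\lambda r_B)$, and for a fixed $\eta>0$ let $\widehat B=(1+\eta)B$. Let $0<\rho\le 1$, $\tau\ge 1$ and $1<p<\infty$. There is a constant $C$, depending only on $p,\rho,\tau,\eta$ and $\mu$, with the following property. Let $B_0$ be a ball, let $f$ be a real-valued measurable function on $\tau\widehat B_0$, and let $a$ be a functional that assigns a number $a(B)\in[0,\infty)$ to every ball $B\subset\tau\widehat B_0$. Suppose that $$\Big(\inf_{c\in\mathbb R}\frac1{\mu(B)}\int_B|f-c|^\rho\,d\mu\Big)^{1/\rho}\le a(\tau B)\qquad\text{for every ball }B\text{ with }\tau B\subset\tau\widehat B_0,$$ and that $a\in D_p(\tau\widehat B_0)$, i.e. $$\|a\|_{D_p(\tau\widehat B_0)}:=\sup_{B\subset\tau\widehat B_0}\ \frac1{a(B)}\,\sup_{\{B_i\}}\Big(\frac1{\mu(B)}\sum_i a(B_i)^p\mu(B_i)\Big)^{1/p}<\infty,$$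 where the inner supremum is over all families $\{B_i\}_i$ of pairwise disjoint balls $B_i\subset B$, and where, if $a(B)=0$, the quotient is read as $0$ when the inner supremum is $0$ and as $\infty$ otherwise. Then, for every ball $B$ with $\tau\widehat B\subset\tau\widehat B_0$, the function $f$ is integrable on $B$ and, with $f_B=\frac1{\mu(B)}\int_B f\,d\mu$, $$\|f-f_B\|_{L^{p,\infty},B}:=\sup_{t>0}\,t\,\Big(\frac{\mu(\{x\in B:|f(x)-f_B|>t\})}{\mu(B)}\Big)^{1/p}\le C\,\|a\|_{D_p(\tau\widehat B_0)}\,a(\tau\widehat B).$$ -/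

import Mathlib

open MeasureTheory
open scoped ENNReal NNReal

/-- An open ball of `X` together with its center and its positive finite radius. -/
structure MBall (X : Type*) where
  center : X
  radius : ℝ
  radius_pos : 0 < radius

namespace MBall

variable {X : Type*}

/-- The dilate `tB = B(x_B, t r_B)`. -/
def dilate (t : ℝ) (ht : 0 < t) (B : MBall X) : MBall X :=
  ⟨B.center, t * B.radius, mul_pos ht B.radius_pos⟩

/-- The enlarged ball `(1 + η)B`. -/
def hat (η : ℝ) (hη : 0 < η) (B : MBall X) : MBall X :=
  B.dilate (1 + η) (add_pos one_pos hη)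

/-- The point set `{y : d(y, x_B) < r_B}` of a ball. -/
def toSet [MetricSpace X] (B : MBall X) : Set X :=
  Metric.ball B.center B.radius

end MBall

/-- `μ` is a doubling measure on `X`, and every ball has positive and finite measure. -/
structure IsDoublingMeasure {X : Type*} [MetricSpace X] [MeasurableSpace X]
    (μ : Measure X) : Prop where
  pos : ∀ B : MBall X, 0 < μ B.toSet
  lt_top : ∀ B : MBall X, μ B.toSet < ∞
  doubling : ∃ c : ℝ≥0, ∀ B : MBall X, μ (B.dilate 2 two_pos).toSet ≤ c * μ B.toSet

section

variable {X : Type*} [MetricSpace X] [MeasurableSpace X]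

/-- `(inf_{c ∈ ℝ} ⨍_B |f - c|^ρ dμ)^{1/ρ}`, with values in `[0, ∞]`. -/
noncomputable def ballOscillation (μ : Measure X) (ρ : ℝ) (f : X → ℝ) (B : MBall X) : ℝ≥0∞ :=
  (⨅ c : ℝ, ⨍⁻ x in B.toSet, ‖f x - c‖ₑ ^ ρ ∂μ) ^ (1 / ρ)

/-- The weak norm of `g` in `L^{p,∞}(B, dμ/μ(B))`, that is,
`sup_{t > 0} t (μ{x ∈ B : |g(x)| > t} / μ(B))^{1/p}`. -/
noncomputable def weakLpNorm (μ : Measure X) (p : ℝ) (g : X → ℝ) (B : MBall X) : ℝ≥0∞ :=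
  ⨆ (t : ℝ) (_ : 0 < t),
    ENNReal.ofReal t * (μ {x ∈ B.toSet | t < |g x|} / μ B.toSet) ^ (1 / p)

/-- `‖a‖_{D_p,B} = a(B)⁻¹ sup (μ(B)⁻¹ ∑ᵢ a(Bᵢ)^p μ(Bᵢ))^{1/p}`, the supremum being over all
families of pairwise disjoint balls `Bᵢ ⊆ B`. In `[0, ∞]`, `0 / 0 = 0` and `s / 0 = ∞` for
`s ≠ 0`, so this is the least `K` for which every such family satisfies
`∑ᵢ a(Bᵢ)^p μ(Bᵢ) ≤ K^p a(B)^p μ(B)`. -/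
noncomputable def DpNormAt (μ : Measure X) (p : ℝ) (a : MBall X → ℝ≥0) (B : MBall X) : ℝ≥0∞ :=
  (⨆ (S : Set (MBall X)) (_ : S.PairwiseDisjoint MBall.toSet) (_ : ∀ B' ∈ S, B'.toSet ⊆ B.toSet),
    ((∑' B' : S, (a B' : ℝ≥0∞) ^ p * μ (B' : MBall X).toSet) / μ B.toSet) ^ (1 / p)) / a B

/-- `‖a‖_{D_p(B₁)} = sup_{B ⊆ B₁} ‖a‖_{D_p,B}`. It involves the values of `a` only at balls
contained in `B₁`. -/
noncomputable def DpNorm (μ : Measure X) (p : ℝ) (a : MBall X → ℝ≥0) (B₁ : MBall X) : ℝ≥0∞ :=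
  ⨆ (B : MBall X) (_ : B.toSet ⊆ B₁.toSet), DpNormAt μ p a B

end

open Metric Set Filter
open scoped Topology

/-! The proof is a good-λ iteration in the style of John and Nirenberg. Write T for (essentially)
‖a‖ a(τB̂), D for the doubling constant, and g = f - c₀ with c₀ nearly optimal on B̂. Around almost
every point of S = {|g| > t} take the first dyadic radius s at which S has density at least 1/(2D);
S is then sparse in the ball of radius 2s. If a(B(x, 5τs)) ≤ γt, the oscillation hypothesis on B(x,
5s) gives a constant c near g off a small fraction of the ball. Sparseness forces |c| < 2t, so {|g|
> Λt}, Λ ≥ 3, fills only that fraction. The remaining balls have a > γt, and the D_p condition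
bounds the total measure of a disjoint subfamily by (T/γt)^p μ(τB̂). This is `measure_level_le`.

Running it along t_k = Λ^k L T on balls shrinking from B̂ towards B gives F(k+1) ≤ F(k)/2 + const
for F(k) = t_k^p μ{|g| > t_k}, hence weak L^p with constant c₀ (`exists_weak_bound`). Since ρ may be
below 1, the mean of f enters only afterwards: weak L^p with p > 1 implies integrability and bounds
|f_B - c₀| (`integrable_and_weak_bound_average`). -/

theorem exists_disjoint_balls_covering {X : Type*} [MetricSpace X] (s : X → ℝ) (P : Set X) (R : ℝ)
    (hs : ∀ x ∈ P, 0 < s x) (hR : ∀ x ∈ P, s x ≤ R) :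
    ∃ u ⊆ P, u.PairwiseDisjoint (fun x => ball x (s x)) ∧
      P ⊆ ⋃ x ∈ u, ball x (5 * s x) := by
  obtain ⟨u, hu, hd, hc⟩ := Vitali.exists_disjoint_subfamily_covering_enlargement
    (fun x => ball x (s x)) P s 2 one_lt_two (fun x hx => (hs x hx).le) R hR
    (fun x hx => ⟨x, mem_ball_self (hs x hx)⟩)
  refine ⟨u, hu, hd, fun x hx => ?_⟩
  obtain ⟨y, hy, ⟨z, hzx, hzy⟩, hxy⟩ := hc x hx
  refine mem_iUnion₂.2 ⟨y, hy, ?_⟩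
  have := hs y (hu hy)
  -- Here dist x y < s x + s y ≤ 3 s y. The factor 5 is generous, because only the centers have to
  -- be covered.
  have h := dist_triangle_left x y z
  simp only [mem_ball] at hzx hzy ⊢
  linarith

/-! ### Doubling measures: separability and density -/

section Doubling

variable {X : Type*} [MetricSpace X] [MeasurableSpace X] {μ : Measure X}

namespace IsDoublingMeasure

theorem ball_pos (hμ : IsDoublingMeasure μ) (x : X) {r : ℝ} (hr : 0 < r) : 0 < μ (ball x r) :=
  hμ.pos ⟨x, r, hr⟩

theorem ball_lt_top (hμ : IsDoublingMeasure μ) (x : X) (r : ℝ) : μ (ball x r) < ∞ := by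
  rcases le_or_gt r 0 with hr | hr
  · simp [ball_eq_empty.2 hr]
  · exact hμ.lt_top ⟨x, r, hr⟩

theorem exists_const (hμ : IsDoublingMeasure μ) :
    ∃ D : ℝ≥0, 1 ≤ D ∧ ∀ (x : X) (r : ℝ), 0 < r → μ (ball x (2 * r)) ≤ D * μ (ball x r) := by
  obtain ⟨c, hc⟩ := hμ.doubling
  refine ⟨max c 1, le_max_right _ _, fun x r hr => (hc ⟨x, r, hr⟩).trans ?_⟩
  gcongr
  · exact le_max_left _ _
  · exact subset_rfl

theorem isLocallyFiniteMeasure (hμ : IsDoublingMeasure μ) : IsLocallyFiniteMeasure μ :=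
  ⟨fun x => ⟨ball x 1, ball_mem_nhds x one_pos, hμ.ball_lt_top x 1⟩⟩

/-- Closed balls replace open ones at the price of a second doubling. Makes the Lebesgue density
theorem available. -/
theorem isUnifLocDoublingMeasure (hμ : IsDoublingMeasure μ) : IsUnifLocDoublingMeasure μ := by
  obtain ⟨D, -, hD⟩ := hμ.exists_const
  refine ⟨D ^ 2, ?_⟩
  filter_upwards [self_mem_nhdsWithin] with ε hε x
  have hε : 0 < ε := hε
  calc μ (closedBall x (2 * ε)) ≤ μ (ball x (2 * (2 * ε))) :=
        measure_mono (closedBall_subset_ball (by linarith))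
    _ ≤ D * (D * μ (ball x ε)) := (hD x _ (by linarith)).trans (by gcongr; exact hD x ε hε)
    _ ≤ (D ^ 2 : ℝ≥0) * μ (closedBall x ε) := by
        rw [← mul_assoc]
        push_cast
        rw [sq]
        gcongr
        exact ball_subset_closedBall

end IsDoublingMeasure

theorem measure_ball_two_pow_mul_le {D : ℝ≥0}
    (hD : ∀ (x : X) (r : ℝ), 0 < r → μ (ball x (2 * r)) ≤ D * μ (ball x r))
    (n : ℕ) (x : X) {r : ℝ} (hr : 0 < r) : μ (ball x (2 ^ n * r)) ≤ D ^ n * μ (ball x r) := by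
  induction n with
  | zero => simp
  | succ n ih =>
    rw [pow_succ', mul_assoc, pow_succ', mul_assoc]
    exact (hD x _ (by positivity)).trans (by gcongr)

theorem measure_ball_le_two_pow {D : ℝ≥0}
    (hD : ∀ (x : X) (r : ℝ), 0 < r → μ (ball x (2 * r)) ≤ D * μ (ball x r))
    (n : ℕ) (x : X) {r s : ℝ} (hr : 0 < r) (h : s ≤ 2 ^ n * r) :
    μ (ball x s) ≤ D ^ n * μ (ball x r) :=
  (measure_mono (ball_subset_ball h)).trans (measure_ball_two_pow_mul_le hD n x hr)

/-- A ball has finite measure, so it contains only countably many disjoint balls, each of positive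
measure; hence a maximal-type separated set is countable. Used for countability of the Vitali
families. -/
theorem IsDoublingMeasure.secondCountableTopology [OpensMeasurableSpace X]
    (hμ : IsDoublingMeasure μ) : SecondCountableTopology X := by
  refine Metric.secondCountable_of_almost_dense_set fun ε hε => ?_
  obtain ⟨u, -, hd, hc⟩ := exists_disjoint_balls_covering (fun _ : X => ε / 5) univ (ε / 5)
    (fun _ _ => by positivity) (fun _ _ => le_rfl)
  refine ⟨u, ?_, fun x => ?_⟩
  · rcases isEmpty_or_nonempty X with h | ⟨⟨x₀⟩⟩
    · exact u.to_countable
    have key : ∀ n : ℕ, (u ∩ ball x₀ n).Countable := by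
      intro n
      have : ((μ.restrict (ball x₀ (n + ε))) univ) ≠ ∞ := by
        simpa using (hμ.ball_lt_top x₀ _).ne
      have : IsFiniteMeasure (μ.restrict (ball x₀ (n + ε))) := ⟨this.lt_top⟩
      have hcount := Measure.countable_meas_pos_of_disjoint_iUnion
        (μ := μ.restrict (ball x₀ (n + ε))) (As := fun i : u => ball (i : X) (ε / 5))
        (fun i => measurableSet_ball)
        (fun i j hij => hd i.2 j.2 (fun h => hij (Subtype.ext h)))
      refine (hcount.image Subtype.val).mono ?_
      rintro x ⟨hxu, hx⟩
      refine ⟨⟨x, hxu⟩, ?_, rfl⟩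
      have hsub : ball x (ε / 5) ⊆ ball x₀ (n + ε) :=
        ball_subset_ball' (by have := mem_ball.1 hx; linarith)
      change 0 < μ.restrict (ball x₀ (n + ε)) (ball x (ε / 5))
      rw [Measure.restrict_apply measurableSet_ball, inter_eq_self_of_subset_left hsub]
      exact hμ.ball_pos x (by positivity)
    refine (countable_iUnion key).mono fun x hx => ?_
    obtain ⟨n, hn⟩ := exists_nat_gt (dist x x₀)
    exact mem_iUnion.2 ⟨n, hx, hn⟩
  · obtain ⟨y, hy, hxy⟩ := mem_iUnion₂.1 (hc (mem_univ x))
    refine ⟨y, hy, ?_⟩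
    have := mem_ball.1 hxy
    linarith

/-- The Lebesgue density theorem in the form used for stopping times: almost every point of `S`
is the center of a ball of radius `2⁻ʲ s` in which `S` has density at least `1 / (2D)`. -/
theorem IsDoublingMeasure.ae_exists_density [BorelSpace X] (hμ : IsDoublingMeasure μ) {D : ℝ≥0}
    (hD : ∀ (x : X) (r : ℝ), 0 < r → μ (ball x (2 * r)) ≤ D * μ (ball x r))
    (S : Set X) {s : ℝ} (hs : 0 < s) :
    ∀ᵐ x ∂μ.restrict S, ∃ j : ℕ,
      μ (ball x ((1 / 2) ^ j * s)) ≤ 2 * D * μ (S ∩ ball x ((1 / 2) ^ j * s)) := by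
  have := hμ.secondCountableTopology
  have := hμ.isLocallyFiniteMeasure
  have := hμ.isUnifLocDoublingMeasure
  filter_upwards [IsUnifLocDoublingMeasure.ae_tendsto_measure_inter_div μ S 1] with x hx
  have hpos : ∀ j : ℕ, 0 < (1 / 2 : ℝ) ^ (j + 1) * s := fun j => by positivity
  have h0 : Tendsto (fun j : ℕ => (1 / 2 : ℝ) ^ (j + 1) * s) atTop (𝓝[>] 0) := by
    refine tendsto_nhdsWithin_iff.2 ⟨?_, Eventually.of_forall hpos⟩
    have := ((tendsto_pow_atTop_nhds_zero_of_lt_one (r := (1 / 2 : ℝ)) (by norm_num)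
      (by norm_num)).comp (tendsto_add_atTop_nat 1)).mul_const s
    simpa using this
  have h1 := hx (fun _ => x) _ h0
    (Eventually.of_forall fun j => by simpa using (hpos j).le)
  obtain ⟨j, hj⟩ := (h1.eventually (lt_mem_nhds (show (1 / 2 : ℝ≥0∞) < 1 by simp))).exists
  refine ⟨j, ?_⟩
  set r := (1 / 2 : ℝ) ^ (j + 1) * s with hr
  have hr2 : (1 / 2 : ℝ) ^ j * s = 2 * r := by rw [hr, pow_succ]; ring
  have hrpos : 0 < r := hpos j
  have hfin : μ (closedBall x r) ≠ ∞ :=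
    ((measure_mono (closedBall_subset_ball (lt_two_mul_self hrpos))).trans_lt
      (hμ.ball_lt_top x _)).ne
  have h2 : μ (closedBall x r) ≤ 2 * μ (S ∩ closedBall x r) := by
    have := ENNReal.mul_lt_of_lt_div hj
    calc μ (closedBall x r) = 2 * (1 / 2 * μ (closedBall x r)) := by
          rw [← mul_assoc, one_div, ENNReal.mul_inv_cancel two_ne_zero ENNReal.ofNat_ne_top, one_mul]
      _ ≤ _ := by gcongr
  rw [hr2]
  calc μ (ball x (2 * r)) ≤ D * μ (ball x r) := hD x r hrpos
    _ ≤ D * (2 * μ (S ∩ closedBall x r)) := by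
        gcongr
        exact (measure_mono ball_subset_closedBall).trans h2
    _ = 2 * D * μ (S ∩ closedBall x r) := by ring
    _ ≤ _ := by
        gcongr
        exact closedBall_subset_ball (lt_two_mul_self hrpos)

end Doubling

/-! ### Stopping balls and the good-λ step -/

section Stopping

variable {X : Type*} [MetricSpace X] [MeasurableSpace X] [BorelSpace X] {μ : Measure X}

/-- Almost every point of `S ∩ U` has a stopping radius, provided that `S` has small density at
scale `s₀` around all points of `U`. -/
theorem IsDoublingMeasure.ae_exists_stopping_radius (hμ : IsDoublingMeasure μ) {D : ℝ≥0}
    (hD : ∀ (x : X) (r : ℝ), 0 < r → μ (ball x (2 * r)) ≤ D * μ (ball x r))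
    {S U : Set X} (hS : MeasurableSet S) {s₀ : ℝ} (hs₀ : 0 < s₀)
    (hsmall : ∀ x ∈ U, 2 * D * μ (S ∩ ball x s₀) < μ (ball x s₀)) :
    ∀ᵐ x ∂μ, x ∈ S → x ∈ U → ∃ s, 0 < s ∧ s ≤ s₀ / 2 ∧
      μ (ball x s) ≤ 2 * D * μ (S ∩ ball x s) ∧
      2 * D * μ (S ∩ ball x (2 * s)) < μ (ball x (2 * s)) := by
  filter_upwards [(ae_restrict_iff' hS).1 (hμ.ae_exists_density hD S hs₀)] with x hx hxS hxU
  classical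
  have hex := hx hxS
  obtain ⟨j, hj⟩ : ∃ j, Nat.find hex = j + 1 := by
    -- The first dense scale is not s₀ itself, so its double is one of the tested scales and is
    -- sparse by minimality.
    refine Nat.exists_eq_succ_of_ne_zero fun h0 => ?_
    have := Nat.find_spec hex
    rw [h0] at this
    simp only [pow_zero, one_mul] at this
    exact (hsmall x hxU).not_ge this
  have hmin := Nat.find_min hex (m := j) (by omega)
  have hspec := Nat.find_spec hex
  rw [hj] at hspec
  have h2 : 2 * ((1 / 2 : ℝ) ^ (j + 1) * s₀) = (1 / 2) ^ j * s₀ := by rw [pow_succ]; ring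
  refine ⟨(1 / 2) ^ (j + 1) * s₀, by positivity, ?_, hspec, ?_⟩
  · have : (1 / 2 : ℝ) ^ j ≤ 1 := pow_le_one₀ (by norm_num) (by norm_num)
    rw [pow_succ]
    nlinarith
  · rw [h2]
    exact not_le.1 hmin

/-- If `|g| > t` on less than half of a ball, and `|g - c| ≥ t` on at most half of it,
then `|c| < 2t`. -/
theorem abs_lt_two_mul_of_measure_lt {X : Type*} [MeasurableSpace X] {μ : Measure X} {g : X → ℝ} {B : Set X} {t c : ℝ}
    (h1 : 2 * μ ({y | t < |g y|} ∩ B) < μ B)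
    (h2 : 2 * μ {y ∈ B | t ≤ |g y - c|} ≤ μ B) (hfin : μ B ≠ ∞) : |c| < 2 * t := by
  by_contra! hc
  have hsub : B ⊆ ({y | t < |g y|} ∩ B) ∪ {y ∈ B | t ≤ |g y - c|} := by
    intro y hy
    by_cases h : t < |g y|
    · exact Or.inl ⟨h, hy⟩
    · refine Or.inr ⟨hy, ?_⟩
      have := abs_sub_abs_le_abs_sub c (g y)
      rw [abs_sub_comm c] at this
      linarith [not_lt.1 h]
  have h3 : 2 * μ B < 2 * μ B :=
    calc 2 * μ B ≤ 2 * μ ({y | t < |g y|} ∩ B) + 2 * μ {y ∈ B | t ≤ |g y - c|} := by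
          rw [← mul_add]
          gcongr
          exact (measure_mono hsub).trans (measure_union_le _ _)
      _ < μ B + μ B := ENNReal.add_lt_add_of_lt_of_le
          (h2.trans_lt hfin.lt_top).ne h1 h2
      _ = 2 * μ B := (two_mul _).symm
  exact lt_irrefl _ h3

/-- One step of the iteration: the measure of the higher level set is estimated by that of the lower
one on a larger ball and the total measure of the balls on which `g` oscillates too much. -/
theorem IsDoublingMeasure.measure_level_le (hμ : IsDoublingMeasure μ) {D : ℝ≥0} (hD1 : 1 ≤ D)
    (hD : ∀ (x : X) (r : ℝ), 0 < r → μ (ball x (2 * r)) ≤ D * μ (ball x r))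
    {g : X → ℝ} (hg : Measurable g) {x₀ : X} {R R' s₀ t Λ κ : ℝ} (hs₀ : 0 < s₀)
    (hR : R' + s₀ ≤ R) (ht : 0 < t) (hΛ : 3 ≤ Λ) (hκ : 0 < κ) {e N : ℝ≥0∞}
    (he : 2 * e * D ^ 2 ≤ 1) (bad : X → ℝ → Prop)
    (hsmall : ∀ x ∈ ball x₀ R', 2 * D * μ ({y | t < |g y|} ∩ ball x s₀) < μ (ball x s₀))
    (hgood : ∀ x ∈ ball x₀ R', ∀ s, 0 < s → s ≤ s₀ / 2 → ¬ bad x s →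
      ∃ c, μ {y ∈ ball x (5 * s) | t ≤ |g y - c|} ≤ e * μ (ball x (5 * s)))
    (hbad : ∀ u ⊆ ball x₀ R', ∀ s : X → ℝ, (∀ x ∈ u, 0 < s x ∧ s x ≤ s₀ / 2 ∧ bad x (s x)) →
      u.PairwiseDisjoint (fun x => ball x (κ * s x)) →
      ∑' x : u, μ (ball (x : X) (κ * s x)) ≤ N) :
    μ ({y | Λ * t < |g y|} ∩ ball x₀ R') ≤
      2 * e * D ^ 4 * μ ({y | t < |g y|} ∩ ball x₀ R) + D ^ 3 * N := by
  have := hμ.secondCountableTopology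
  set S := {y | t < |g y|} with hSdef
  have hS : MeasurableSet S := measurableSet_lt measurable_const hg.abs
  have hD1' : (1 : ℝ≥0∞) ≤ D := by exact_mod_cast hD1
  set A := {x | x ∈ S ∧ x ∈ ball x₀ R' ∧ ∃ s, 0 < s ∧ s ≤ s₀ / 2 ∧
      μ (ball x s) ≤ 2 * D * μ (S ∩ ball x s) ∧
      2 * D * μ (S ∩ ball x (2 * s)) < μ (ball x (2 * s))} with hA
  have hAs : ∀ x : X, ∃ s, x ∈ A → 0 < s ∧ s ≤ s₀ / 2 ∧
      μ (ball x s) ≤ 2 * D * μ (S ∩ ball x s) ∧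
      2 * D * μ (S ∩ ball x (2 * s)) < μ (ball x (2 * s)) := by
    intro x
    by_cases hx : x ∈ A
    · obtain ⟨s, hs⟩ := hx.2.2
      exact ⟨s, fun _ => hs⟩
    · exact ⟨0, fun h => absurd h hx⟩
  choose s hs using hAs
  have h5 : ∀ (x : X) (r : ℝ), 0 < r → μ (ball x (5 * r)) ≤ D ^ 3 * μ (ball x r) :=
    fun x r hr => measure_ball_le_two_pow hD 3 x hr (by linarith)
  obtain ⟨u, hu, hud, huc⟩ := exists_disjoint_balls_covering s {x ∈ A | ¬ bad x (s x)} (s₀ / 2)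
    (fun x hx => (hs x hx.1).1) (fun x hx => (hs x hx.1).2.1)
  -- For bad centers the balls enlarged by κ are made disjoint, since `hbad` sums over those.
  obtain ⟨v, hv, hvd, hvc⟩ := exists_disjoint_balls_covering (fun x => κ * s x)
    {x ∈ A | bad x (s x)} (κ * (s₀ / 2))
    (fun x hx => mul_pos hκ (hs x hx.1).1)
    (fun x hx => mul_le_mul_of_nonneg_left (hs x hx.1).2.1 hκ.le)
  have hucount : u.Countable := hud.countable_of_isOpen (fun _ _ => isOpen_ball)
    (fun x hx => ⟨x, mem_ball_self (hs x (hu hx).1).1⟩)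
  have hvcount : v.Countable := hvd.countable_of_isOpen (fun _ _ => isOpen_ball)
    (fun x hx => ⟨x, mem_ball_self (mul_pos hκ (hs x (hv hx).1).1)⟩)
  have hcover : ({y | Λ * t < |g y|} ∩ ball x₀ R' : Set X) ≤ᵐ[μ]
      ((⋃ x ∈ u, {y | Λ * t < |g y|} ∩ ball x (5 * s x)) ∪
        ⋃ x ∈ v, ball x (5 * (κ * s x)) : Set X) := by
    filter_upwards [hμ.ae_exists_stopping_radius hD hS hs₀ hsmall] with x hx hxm
    have hxS : x ∈ S := by
      have : Λ * t < |g x| := hxm.1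
      simp only [hSdef, mem_ofPred_eq]
      nlinarith
    have hxA : x ∈ A := ⟨hxS, hxm.2, hx hxS hxm.2⟩
    by_cases hb : bad x (s x)
    · exact Or.inr (hvc ⟨hxA, hb⟩)
    · refine Or.inl ?_
      obtain ⟨y, hy, hxy⟩ := mem_iUnion₂.1 (huc ⟨hxA, hb⟩)
      exact mem_iUnion₂.2 ⟨y, hy, hxm.1, hxy⟩
  have hgoodball : ∀ x ∈ u, μ ({y | Λ * t < |g y|} ∩ ball x (5 * s x)) ≤
      2 * e * D ^ 4 * μ (S ∩ ball x (s x)) := by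
    intro x hx
    obtain ⟨hxA, hxb⟩ := hu hx
    obtain ⟨hs1, hs2, hs3, hs4⟩ := hs x hxA
    obtain ⟨c, hc⟩ := hgood x hxA.2.1 _ hs1 hs2 hxb
    have hcabs : |c| < 2 * t := by
      refine abs_lt_two_mul_of_measure_lt (μ := μ) (g := g) (B := ball x (2 * s x)) ?_ ?_
        (hμ.ball_lt_top _ _).ne
      · refine lt_of_le_of_lt ?_ hs4
        gcongr
        exact le_mul_of_one_le_right' hD1'
      · calc 2 * μ {y ∈ ball x (2 * s x) | t ≤ |g y - c|}
            ≤ 2 * μ {y ∈ ball x (5 * s x) | t ≤ |g y - c|} := by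
              gcongr 2 * μ ?_
              exact fun y hy => ⟨ball_subset_ball (by linarith) hy.1, hy.2⟩
          _ ≤ 2 * (e * (D ^ 2 * μ (ball x (2 * s x)))) := by
              gcongr
              refine hc.trans ?_
              gcongr
              exact measure_ball_le_two_pow hD 2 x (by linarith) (by linarith)
          _ = (2 * e * D ^ 2) * μ (ball x (2 * s x)) := by ring
          _ ≤ 1 * μ (ball x (2 * s x)) := by gcongr
          _ = _ := one_mul _
    calc μ ({y | Λ * t < |g y|} ∩ ball x (5 * s x))
        ≤ μ {y ∈ ball x (5 * s x) | t ≤ |g y - c|} := by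
          refine measure_mono fun y hy => ⟨hy.2, ?_⟩
          have h1 : Λ * t < |g y| := hy.1
          have h2 := abs_sub_abs_le_abs_sub (g y) c
          -- |g y - c| ≥ |g y| - |c| > Λt - 2t ≥ t; this is where Λ ≥ 3 enters.
          nlinarith
      _ ≤ e * (D ^ 3 * (2 * D * μ (S ∩ ball x (s x)))) := by
          refine hc.trans ?_
          gcongr
          exact (h5 x _ hs1).trans (by gcongr)
      _ = _ := by ring
  refine (measure_mono_ae hcover).trans ((measure_union_le _ _).trans (add_le_add ?_ ?_))
  · calc μ (⋃ x ∈ u, {y | Λ * t < |g y|} ∩ ball x (5 * s x))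
        ≤ ∑' x : u, μ ({y | Λ * t < |g y|} ∩ ball (x : X) (5 * s x)) :=
          measure_biUnion_le μ hucount _
      _ ≤ ∑' x : u, 2 * e * D ^ 4 * μ (S ∩ ball (x : X) (s x)) :=
          ENNReal.tsum_le_tsum fun x => hgoodball x x.2
      _ = 2 * e * D ^ 4 * μ (⋃ x ∈ u, S ∩ ball (x : X) (s x)) := by
          rw [ENNReal.tsum_mul_left, measure_biUnion hucount
            (fun x hx y hy hxy => (hud hx hy hxy).mono inter_subset_right inter_subset_right)
            (fun x _ => hS.inter measurableSet_ball)]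
      _ ≤ _ := by
          gcongr
          refine iUnion₂_subset fun x hx => inter_subset_inter_right _ ?_
          obtain ⟨hxA, -⟩ := hu hx
          have h1 := mem_ball.1 hxA.2.1
          have h2 := (hs x hxA).2.1
          exact ball_subset_ball' (by linarith)
  · calc μ (⋃ x ∈ v, ball x (5 * (κ * s x)))
        ≤ ∑' x : v, μ (ball (x : X) (5 * (κ * s x))) := measure_biUnion_le μ hvcount _
      _ ≤ ∑' x : v, D ^ 3 * μ (ball (x : X) (κ * s x)) :=
          ENNReal.tsum_le_tsum fun x => h5 x _ (mul_pos hκ (hs x (hv x.2).1).1)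
      _ = D ^ 3 * ∑' x : v, μ (ball (x : X) (κ * s x)) := ENNReal.tsum_mul_left
      _ ≤ _ := by
          gcongr
          refine hbad v (fun x hx => (hv hx).1.2.1) s (fun x hx => ?_) hvd
          have h := hs x (hv hx).1
          exact ⟨h.1, h.2.1, (hv hx).2⟩

end Stopping

/-! ### Iteration over levels and shrinking balls -/

section Iteration

/-- Chebyshev's inequality for the power `ρ`. -/
theorem measure_le_of_lintegral_enorm_sub_rpow_le {X : Type*} [MeasurableSpace X] {μ : Measure X}
    {g : X → ℝ} (hg : Measurable g) {B : Set X} (hB : MeasurableSet B) {c b t ρ : ℝ}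
    (hρ : 0 < ρ) (hb : 0 ≤ b) (ht : 0 < t)
    (h : ∫⁻ y in B, ‖g y - c‖ₑ ^ ρ ∂μ ≤ ENNReal.ofReal (b ^ ρ) * μ B) :
    μ {y ∈ B | t ≤ |g y - c|} ≤ ENNReal.ofReal ((b / t) ^ ρ) * μ B := by
  have hset : {y ∈ B | t ≤ |g y - c|} ⊆
      {y | ENNReal.ofReal (t ^ ρ) ≤ ‖g y - c‖ₑ ^ ρ} ∩ B := by
    rintro y ⟨hyB, hy⟩
    refine ⟨?_, hyB⟩
    simp only [mem_ofPred_eq]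
    rw [← ENNReal.ofReal_rpow_of_pos ht, ← ofReal_norm]
    exact ENNReal.rpow_le_rpow (ENNReal.ofReal_le_ofReal hy) hρ.le
  have htρ : 0 < t ^ ρ := Real.rpow_pos_of_pos ht ρ
  have h1 : ENNReal.ofReal (t ^ ρ) * μ {y ∈ B | t ≤ |g y - c|} ≤
      ENNReal.ofReal (b ^ ρ) * μ B := by
    refine le_trans ?_ h
    refine le_trans ?_ (mul_meas_ge_le_lintegral₀ (μ := μ.restrict B) (by fun_prop)
      (ENNReal.ofReal (t ^ ρ)))
    rw [Measure.restrict_apply' hB]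
    gcongr
  calc μ {y ∈ B | t ≤ |g y - c|}
      = ENNReal.ofReal (t ^ ρ)⁻¹ * (ENNReal.ofReal (t ^ ρ) * μ {y ∈ B | t ≤ |g y - c|}) := by
        rw [← mul_assoc, ← ENNReal.ofReal_mul (by positivity), inv_mul_cancel₀ htρ.ne',
          ENNReal.ofReal_one, one_mul]
    _ ≤ ENNReal.ofReal (t ^ ρ)⁻¹ * (ENNReal.ofReal (b ^ ρ) * μ B) := by gcongr
    _ = _ := by
        rw [← mul_assoc, ← ENNReal.ofReal_mul (by positivity), Real.div_rpow hb ht.le,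
          div_eq_inv_mul]

theorem exists_pos_rpow_eq {ρ y : ℝ} (hρ : 0 < ρ) (hy : 0 < y) : ∃ z : ℝ, 0 < z ∧ z ^ ρ = y :=
  ⟨y ^ ρ⁻¹, by positivity, Real.rpow_inv_rpow hy.le hρ.ne'⟩

theorem ofReal_combine {a b c d e f : ℝ} (ha : 0 ≤ a) (hb : 0 ≤ b) (hc : 0 ≤ c) (hd : 0 ≤ d)
    (he : 0 ≤ e) (hf : 0 ≤ f) (m : ℝ≥0∞) :
    2 * ENNReal.ofReal a * ENNReal.ofReal b * (ENNReal.ofReal c * m) +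
      ENNReal.ofReal d * (ENNReal.ofReal e * (ENNReal.ofReal f * m)) =
    ENNReal.ofReal (2 * a * b * c + d * (e * f)) * m := by
  rw [ENNReal.ofReal_add (by positivity) (by positivity), ENNReal.ofReal_mul (by positivity),
    ENNReal.ofReal_mul (by positivity), ENNReal.ofReal_mul zero_le_two, ENNReal.ofReal_mul hd,
    ENNReal.ofReal_mul he, ENNReal.ofReal_ofNat]
  ring

variable {X : Type*} [MetricSpace X] [MeasurableSpace X] [BorelSpace X] {μ : Measure X}

set_option maxHeartbeats 1000000 in
/-- The John--Nirenberg type estimate: if the oscillations of `f` on balls are controlled by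
`α`, and `α` is `p`-summable over disjoint balls with bound `T`, then `f` is in weak `L^p`. -/
theorem IsDoublingMeasure.exists_weak_bound (hμ : IsDoublingMeasure μ) {p ρ τ η : ℝ} (hp : 0 < p)
    (hρ₀ : 0 < ρ) (hρ₁ : ρ ≤ 1) (hτ : 1 ≤ τ) (hη : 0 < η) :
    ∃ C : ℝ, 0 ≤ C ∧ ∀ (x₀ : X) (r : ℝ) (f : X → ℝ) (α : X → ℝ → ℝ≥0) (T : ℝ), 0 < r →
      Measurable f → 0 < T →
      (∀ x s, 0 < s → ball x (τ * s) ⊆ ball x₀ (τ * ((1 + η) * r)) → ∀ b : ℝ, α x (τ * s) < b →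
        ∃ c, ∫⁻ y in ball x s, ‖f y - c‖ₑ ^ ρ ∂μ ≤ ENNReal.ofReal (b ^ ρ) * μ (ball x s)) →
      (∀ (u : Set X) (s : X → ℝ), (∀ x ∈ u, 0 < s x) →
        (∀ x ∈ u, ball x (s x) ⊆ ball x₀ (τ * ((1 + η) * r))) →
        u.PairwiseDisjoint (fun x => ball x (s x)) →
        ∑' x : u, (α x (s x) : ℝ≥0∞) ^ p * μ (ball (x : X) (s x)) ≤
          ENNReal.ofReal (T ^ p) * μ (ball x₀ (τ * ((1 + η) * r)))) →
      ∃ c, ∀ t, 0 < t → μ {y ∈ ball x₀ r | t < |f y - c|} ≤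
        ENNReal.ofReal (C * (T / t) ^ p) * μ (ball x₀ r) := by
  obtain ⟨D, hD1, hD⟩ := hμ.exists_const
  have hd1 : (1 : ℝ) ≤ D := by exact_mod_cast hD1
  have hd0 : (0 : ℝ) < D := by linarith
  have hconv : ∀ k : ℕ, (D : ℝ≥0∞) ^ k = ENNReal.ofReal ((D : ℝ) ^ k) := fun k => by
    rw [ENNReal.ofReal_pow hd0.le, ENNReal.ofReal_coe_nnreal]
  -- D^(m+k) compares B̂ with balls of radius σ k, and D^n compares τB̂ with B.
  obtain ⟨m, hm⟩ := pow_unbounded_of_one_lt (2 * (1 + η) / (η / 32)) one_lt_two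
  obtain ⟨n, hn⟩ := pow_unbounded_of_one_lt (τ * (1 + η)) one_lt_two
  -- Each halving of the scale costs a factor D in measure; raising the level by Λ gains 3D in
  -- Chebyshev's inequality.
  obtain ⟨Λ, hΛ0, hΛ⟩ := exists_pos_rpow_eq hρ₀ (show (0 : ℝ) < 3 * D by positivity)
  have hΛ3 : 3 ≤ Λ := by
    by_contra! hlt
    have h1 : Λ ^ ρ < 3 ^ ρ := Real.rpow_lt_rpow hΛ0.le hlt hρ₀
    have h2 : (3 : ℝ) ^ ρ ≤ 3 ^ (1 : ℝ) := Real.rpow_le_rpow_of_exponent_le (by norm_num) hρ₁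
    rw [Real.rpow_one] at h2
    linarith
  have hΛp : 1 ≤ Λ ^ p := Real.one_le_rpow (by linarith) hp.le
  -- Chosen so that 2 γ'^ρ D⁴ = 1/(2Λ^p), the contraction factor 1/2 after multiplying by Λ^p.
  -- Below, γ = γ'/2 leaves room for a strict inequality, as the infimum over c need not be
  -- attained.
  obtain ⟨γ', hγ'0, hγ'⟩ :=
    exists_pos_rpow_eq hρ₀ (show (0 : ℝ) < 1 / (4 * D ^ 4 * Λ ^ p) by positivity)
  obtain ⟨L', hL'0, hL'⟩ :=
    exists_pos_rpow_eq hρ₀ (show (0 : ℝ) < 1 / (4 * D ^ (m + 1)) by positivity)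
  set γ := γ' / 2 with hγ
  set L := 2 / L' with hL
  have hγ0 : 0 < γ := by positivity
  have hL0 : 0 < L := by positivity
  set M : ℝ := D ^ n * L ^ p + 2 * Λ ^ p * (1 / γ) ^ p * D ^ (3 + n) with hM
  have hM0 : 0 ≤ M := by positivity
  refine ⟨M * Λ ^ p + L ^ p, by positivity, fun x₀ r f α T hr hf hT H1 H2 => ?_⟩
  have hΩn : μ (ball x₀ (τ * ((1 + η) * r))) ≤ D ^ n * μ (ball x₀ r) :=
    measure_ball_le_two_pow hD n x₀ hr (by rw [← mul_assoc]; gcongr)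
  -- The summability hypothesis for the one-ball family τB̂.
  have hαT : (α x₀ (τ * ((1 + η) * r)) : ℝ) ≤ T := by
    have hpos := hμ.ball_pos x₀ (show 0 < τ * ((1 + η) * r) by positivity)
    have hfin := hμ.ball_lt_top x₀ (τ * ((1 + η) * r))
    have h := H2 {x₀} (fun _ => τ * ((1 + η) * r)) (fun _ _ => by positivity)
      (fun x hx => by rw [mem_singleton_iff.1 hx]) (pairwiseDisjoint_singleton _ _)
    rw [tsum_singleton x₀ (fun x => (α x (τ * ((1 + η) * r)) : ℝ≥0∞) ^ p *
      μ (ball x (τ * ((1 + η) * r)))), ENNReal.mul_le_mul_iff_left hpos.ne' hfin.ne,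
      ← ENNReal.ofReal_rpow_of_pos hT, ENNReal.rpow_le_rpow_iff hp,
      ← ENNReal.ofReal_coe_nnreal, ENNReal.ofReal_le_ofReal_iff hT.le] at h
    exact h
  obtain ⟨c₀, hc₀⟩ := H1 x₀ ((1 + η) * r) (by positivity) subset_rfl (2 * T) (by linarith)
  refine ⟨c₀, ?_⟩
  set g : X → ℝ := fun y => f y - c₀ with hgdef
  have hg : Measurable g := hf.sub_const c₀
  set t : ℕ → ℝ := fun k => Λ ^ k * (L * T) with htdef
  have ht0 : ∀ k, 0 < t k := fun k => by positivity
  have hts : ∀ k, t (k + 1) = Λ * t k := fun k => by simp only [htdef, pow_succ]; ring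
  set R : ℕ → ℝ := fun k => (1 + η * (1 / 2) ^ (k + 1)) * r with hRdef
  set σ : ℕ → ℝ := fun k => (1 / 2) ^ k * (η / 32 * r) with hσdef
  have hσ0 : ∀ k, 0 < σ k := fun k => by positivity
  have hσR : ∀ k, R (k + 1) + 8 * σ k = R k := fun k => by
    simp only [hRdef, hσdef, pow_succ]; ring
  have hσr : ∀ k, σ k ≤ η / 32 * r := fun k =>
    mul_le_of_le_one_left (by positivity) (pow_le_one₀ (by norm_num) (by norm_num))
  have hR1 : ∀ k, R k ≤ (1 + η / 2) * r := fun k => by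
    have : (1 / 2 : ℝ) ^ k ≤ 1 := pow_le_one₀ (by norm_num) (by norm_num)
    simp only [hRdef, pow_succ]
    gcongr
    nlinarith
  have hRr : ∀ k, r ≤ R k := fun k => by
    simp only [hRdef]
    have : 0 ≤ η * (1 / 2 : ℝ) ^ (k + 1) := by positivity
    nlinarith
  have hηr : 0 < η * r := by positivity
  -- Chebyshev on B̂ bounds the left side by 1/(2·3^k) times the right.
  have hsmall : ∀ k, ∀ x ∈ ball x₀ (R (k + 1)),
      2 * D * μ ({y | t k < |g y|} ∩ ball x (σ k)) < μ (ball x (σ k)) := by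
    intro k x hx
    have hxd := mem_ball.1 hx
    have hσB : ball x (σ k) ⊆ ball x₀ ((1 + η) * r) :=
      ball_subset_ball' (by nlinarith [hσr k, hR1 (k + 1)])
    have hB : μ (ball x₀ ((1 + η) * r)) ≤ D ^ (m + k) * μ (ball x (σ k)) := by
      refine (measure_mono (ball_subset_ball' (ε₂ := 2 * ((1 + η) * r)) ?_)).trans
        (measure_ball_le_two_pow hD (m + k) x (hσ0 k) ?_)
      · rw [dist_comm]
        nlinarith [hR1 (k + 1)]
      · have h1 : (2 : ℝ) ^ (m + k) * σ k = 2 ^ m * (η / 32) * r := by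
          simp only [hσdef, pow_add, one_div, inv_pow]
          field_simp
        have h2 := (div_lt_iff₀ (by positivity)).1 hm
        rw [h1, ← mul_assoc]
        gcongr
    have hcheb := measure_le_of_lintegral_enorm_sub_rpow_le hf measurableSet_ball hρ₀
      (by positivity) (ht0 k) hc₀
    have hval : (2 * T / t k) ^ ρ = 1 / (4 * D ^ (m + 1)) * (1 / (3 * D) ^ k) := by
      have h1 : 2 * T / t k = L' * (1 / Λ ^ k) := by
        simp only [htdef, hL]
        field_simp
      rw [h1, Real.mul_rpow hL'0.le (by positivity), hL',
        Real.div_rpow zero_le_one (by positivity), Real.one_rpow, ← Real.rpow_pow_comm hΛ0.le, hΛ]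
    have hposx := hμ.ball_pos x (hσ0 k)
    have hfinx := hμ.ball_lt_top x (σ k)
    calc 2 * D * μ ({y | t k < |g y|} ∩ ball x (σ k))
        ≤ 2 * D * (ENNReal.ofReal ((2 * T / t k) ^ ρ) * (D ^ (m + k) * μ (ball x (σ k)))) := by
          gcongr
          refine (measure_mono ?_).trans (hcheb.trans (by gcongr))
          exact fun y hy => ⟨hσB hy.2, le_of_lt hy.1⟩
      _ = ENNReal.ofReal (2 * D * ((2 * T / t k) ^ ρ * D ^ (m + k))) * μ (ball x (σ k)) := by
          rw [ENNReal.ofReal_mul (by positivity), ENNReal.ofReal_mul (by positivity),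
            ENNReal.ofReal_mul (by have := ht0 k; positivity), hconv, ENNReal.ofReal_ofNat,
            ENNReal.ofReal_coe_nnreal]
          ring
      _ < 1 * μ (ball x (σ k)) := by
          refine (ENNReal.mul_lt_mul_iff_left hposx.ne' hfinx.ne).2 ?_
          rw [ENNReal.ofReal_lt_one, hval]
          have h3 : (1 : ℝ) ≤ 3 ^ k := one_le_pow₀ (by norm_num)
          have h4 : 2 * D * (1 / (4 * D ^ (m + 1)) * (1 / (3 * D) ^ k) * D ^ (m + k)) =
              1 / (2 * 3 ^ k : ℝ) := by
            rw [mul_pow, pow_add, pow_add]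
            field_simp
            norm_num
          rw [h4, div_lt_one (by positivity)]
          linarith
      _ = _ := one_mul _
  have hin : ∀ k, ∀ x ∈ ball x₀ (R (k + 1)), ∀ s, s ≤ σ k / 2 →
      ball x (τ * (5 * s)) ⊆ ball x₀ (τ * ((1 + η) * r)) := by
    intro k x hx s hs
    refine ball_subset_ball' ?_
    have h1 := (mem_ball.1 hx).le
    have h2 := hR1 (k + 1)
    have h3 := hσr k
    calc τ * (5 * s) + dist x x₀ ≤ τ * (η / 2 * r) + τ * ((1 + η / 2) * r) := by
          refine add_le_add (mul_le_mul_of_nonneg_left (by linarith) (by linarith)) ?_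
          exact (h1.trans h2).trans (le_mul_of_one_le_left (by positivity) hτ)
      _ = _ := by ring
  have hstep : ∀ k, μ ({y | t (k + 1) < |g y|} ∩ ball x₀ (R (k + 1))) ≤
      2 * ENNReal.ofReal (γ' ^ ρ) * D ^ 4 * μ ({y | t k < |g y|} ∩ ball x₀ (R k)) +
        D ^ 3 * (ENNReal.ofReal ((T / (γ * t k)) ^ p) * (D ^ n * μ (ball x₀ r))) := by
    intro k
    rw [hts]
    refine hμ.measure_level_le hD1 hD hg (hσ0 k) (by linarith [hσR k, hσ0 k]) (ht0 k) hΛ3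
      (κ := τ * 5) (by positivity) ?_ (fun x s => γ * t k < α x (τ * (5 * s))) (hsmall k) ?_ ?_
    · rw [hconv, ← ENNReal.ofReal_ofNat 2, ← ENNReal.ofReal_mul (by positivity),
        ← ENNReal.ofReal_mul (by positivity), ENNReal.ofReal_le_one, hγ']
      have h1 : (D : ℝ) ^ 2 ≤ D ^ 4 := pow_le_pow_right₀ hd1 (by norm_num)
      have h2 : (D : ℝ) ^ 2 ≤ D ^ 4 * Λ ^ p := h1.trans (le_mul_of_one_le_right (by positivity) hΛp)
      rw [mul_one_div, div_mul_eq_mul_div, div_le_one (by positivity)]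
      linarith [show (0 : ℝ) ≤ D ^ 4 * Λ ^ p by positivity]
    · intro x hx s hs0 hs hb
      have hb' : (α x (τ * (5 * s)) : ℝ) < γ' * t k := by
        have h1 : γ' = 2 * γ := by rw [hγ]; ring
        have h2 : 0 < γ * t k := mul_pos hγ0 (ht0 k)
        rw [h1]
        linarith
      obtain ⟨c, hc⟩ := H1 x (5 * s) (by positivity) (hin k x hx s hs) _ hb'
      refine ⟨c - c₀, ?_⟩
      have h := measure_le_of_lintegral_enorm_sub_rpow_le hf measurableSet_ball hρ₀
        (mul_pos hγ'0 (ht0 k)).le (ht0 k) hc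
      rw [mul_div_cancel_right₀ _ (ht0 k).ne'] at h
      simpa [hgdef] using h
    · intro u hu s hs hd
      have hγt : 0 < γ * t k := mul_pos hγ0 (ht0 k)
      simp only [mul_assoc] at hd ⊢
      have h := H2 u (fun x => τ * (5 * s x))
        (fun x hx => by have := (hs x hx).1; positivity)
        (fun x hx => hin k x (hu hx) _ (hs x hx).2.1) hd
      calc ∑' x : u, μ (ball (x : X) (τ * (5 * s x)))
          ≤ ∑' x : u, ENNReal.ofReal ((1 / (γ * t k)) ^ p) *
              ((α x (τ * (5 * s x)) : ℝ≥0∞) ^ p * μ (ball (x : X) (τ * (5 * s x)))) := by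
            refine ENNReal.tsum_le_tsum fun x => ?_
            rw [← mul_assoc (ENNReal.ofReal _)]
            refine le_mul_of_one_le_left' ?_
            have hx := (hs x x.2).2.2
            rw [← ENNReal.ofReal_rpow_of_pos (by positivity),
              ← ENNReal.mul_rpow_of_nonneg _ _ hp.le]
            refine ENNReal.one_le_rpow ?_ hp
            rw [← ENNReal.ofReal_coe_nnreal, ← ENNReal.ofReal_mul (by positivity),
              ENNReal.one_le_ofReal, one_div_mul_eq_div, one_le_div hγt]
            exact hx.le
        _ ≤ ENNReal.ofReal ((1 / (γ * t k)) ^ p) *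
              (ENNReal.ofReal (T ^ p) * (D ^ n * μ (ball x₀ r))) := by
            rw [ENNReal.tsum_mul_left]
            gcongr
            exact h.trans (by gcongr)
        _ = _ := by
            rw [← mul_assoc, ← ENNReal.ofReal_mul (by positivity),
              ← Real.mul_rpow (by positivity) hT.le, one_div_mul_eq_div]
  -- The first summand of M handles k = 0; the second makes M a supersolution of the recursion M ↦
  -- (M + const)/2.
  have hF : ∀ k, μ ({y | t k < |g y|} ∩ ball x₀ (R k)) ≤
      ENNReal.ofReal (M * (T / t k) ^ p) * μ (ball x₀ r) := by
    intro k
    induction k with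
    | zero => 
      have h1 : t 0 = L * T := by simp [htdef]
      have h2 : (T / t 0) ^ p = 1 / L ^ p := by
        rw [h1, div_mul_cancel_right₀ hT.ne', Real.inv_rpow hL0.le, one_div]
      calc μ ({y | t 0 < |g y|} ∩ ball x₀ (R 0)) ≤ μ (ball x₀ (τ * ((1 + η) * r))) := by
            refine measure_mono (inter_subset_right.trans (ball_subset_ball ?_))
            have := hR1 0
            have h3 : (1 + η) * r ≤ τ * ((1 + η) * r) :=
              le_mul_of_one_le_left (by positivity) hτ
            linarith
        _ ≤ D ^ n * μ (ball x₀ r) := hΩn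
        _ ≤ _ := by
            rw [hconv]
            gcongr
            rw [h2, mul_one_div, le_div_iff₀ (by positivity), hM]
            exact le_add_of_nonneg_right (by positivity)
    | succ k ih => 
      refine (hstep k).trans ?_
      have htk := ht0 k
      have hTt : 0 ≤ T / t k := by positivity
      calc 2 * ENNReal.ofReal (γ' ^ ρ) * D ^ 4 * μ ({y | t k < |g y|} ∩ ball x₀ (R k)) +
            D ^ 3 * (ENNReal.ofReal ((T / (γ * t k)) ^ p) * (D ^ n * μ (ball x₀ r)))
          ≤ 2 * ENNReal.ofReal (γ' ^ ρ) * D ^ 4 *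
              (ENNReal.ofReal (M * (T / t k) ^ p) * μ (ball x₀ r)) +
            D ^ 3 * (ENNReal.ofReal ((T / (γ * t k)) ^ p) * (D ^ n * μ (ball x₀ r))) := by gcongr
        _ = ENNReal.ofReal (2 * γ' ^ ρ * D ^ 4 * (M * (T / t k) ^ p) +
              D ^ 3 * ((T / (γ * t k)) ^ p * D ^ n)) * μ (ball x₀ r) := by
            rw [hconv, hconv, hconv]
            exact ofReal_combine (by positivity) (by positivity) (by positivity) (by positivity)
              (by positivity) (by positivity) _
        _ ≤ _ := by
            gcongr
            have e1 : (T / (γ * t k)) ^ p = (1 / γ) ^ p * (T / t k) ^ p := by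
              rw [← Real.mul_rpow (by positivity) hTt]
              congr 1
              field_simp
            have e2 : M * (T / t (k + 1)) ^ p = M * ((T / t k) ^ p / Λ ^ p) := by
              rw [← Real.div_rpow hTt hΛ0.le, hts]
              congr 1
              field_simp
            rw [e1, e2, hγ']
            have e3 : 2 * (1 / (4 * D ^ 4 * Λ ^ p)) * D ^ 4 * (M * (T / t k) ^ p) +
                D ^ 3 * ((1 / γ) ^ p * (T / t k) ^ p * D ^ n) =
                ((M + 2 * Λ ^ p * (1 / γ) ^ p * D ^ (3 + n)) / 2) * ((T / t k) ^ p / Λ ^ p) := by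
              rw [pow_add]
              generalize (1 / γ) ^ p = G
              field_simp
              ring
            rw [e3]
            refine mul_le_mul_of_nonneg_right ?_ (by positivity)
            have : 0 ≤ (D : ℝ) ^ n * L ^ p := by positivity
            linarith
  intro t' ht'
  -- Below the starting level the bound exceeds μ(B); above it, t' lies between consecutive levels,
  -- which costs Λ^p.
  rcases lt_or_ge t' (L * T) with hlt | hge
  · have h1 : (1 : ℝ≥0∞) ≤ ENNReal.ofReal ((M * Λ ^ p + L ^ p) * (T / t') ^ p) := by
      rw [ENNReal.one_le_ofReal]
      have h2 : 1 ≤ L ^ p * (T / t') ^ p := by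
        rw [← Real.mul_rpow hL0.le (by positivity)]
        refine Real.one_le_rpow ?_ hp.le
        rw [← mul_div_assoc, one_le_div ht']
        exact hlt.le
      have h3 : 0 ≤ M * Λ ^ p * (T / t') ^ p := by positivity
      linarith
    exact (measure_mono fun y hy => hy.1).trans (le_mul_of_one_le_left' h1)
  · have hLT : 0 < L * T := by positivity
    obtain ⟨k, hk1, hk2⟩ := exists_nat_pow_near ((one_le_div hLT).2 hge)
      (show 1 < Λ by linarith)
    rw [le_div_iff₀ hLT] at hk1
    rw [div_lt_iff₀ hLT] at hk2
    have h1 : T / t k ≤ Λ * (T / t') := by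
      have htk := ht0 k
      have : t' < Λ * t k := by rw [← hts]; exact hk2
      rw [← mul_div_assoc, div_le_div_iff₀ htk ht']
      calc T * t' ≤ T * (Λ * t k) := by gcongr
        _ = Λ * T * t k := by ring
    calc μ {y ∈ ball x₀ r | t' < |f y - c₀|} ≤ μ ({y | t k < |g y|} ∩ ball x₀ (R k)) :=
          measure_mono fun y hy => ⟨lt_of_le_of_lt hk1 hy.2, ball_subset_ball (hRr k) hy.1⟩
      _ ≤ ENNReal.ofReal (M * (T / t k) ^ p) * μ (ball x₀ r) := hF k
      _ ≤ _ := by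
          refine mul_le_mul' (ENNReal.ofReal_le_ofReal ?_) le_rfl
          have htk := ht0 k
          calc M * (T / t k) ^ p ≤ M * (Λ * (T / t')) ^ p := by gcongr
            _ = M * Λ ^ p * (T / t') ^ p := by
                rw [Real.mul_rpow hΛ0.le (by positivity)]; ring
            _ ≤ _ := by
                gcongr
                exact le_add_of_nonneg_right (by positivity)

end Iteration

/-! ### From weak L^p to integrability and the mean -/

section WeakType

/-- A function in weak `L^p` on a set of finite measure, `p > 1`, is integrable. -/
theorem lintegral_enorm_le_of_weak_bound {X : Type*} [MeasurableSpace X] {ν : Measure X}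
    {g : X → ℝ} (hg : AEMeasurable g ν) {p C T : ℝ} (hp : 1 < p) (hC : 0 ≤ C) (hT : 0 < T)
    (h : ∀ t, 0 < t → ν {y | t < |g y|} ≤ ENNReal.ofReal (C * (T / t) ^ p) * ν univ) :
    ∫⁻ y, ‖g y‖ₑ ∂ν ≤ ENNReal.ofReal ((1 + C / (p - 1)) * T) * ν univ := by
  have hp' : 0 < p - 1 := by linarith
  have hlayer : ∫⁻ y, ‖g y‖ₑ ∂ν = ∫⁻ t in Ioi 0, ν {y | t < |g y|} := by
    rw [← lintegral_eq_lintegral_meas_lt ν (Eventually.of_forall fun y => abs_nonneg (g y))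
      (by fun_prop)]
    exact lintegral_congr fun y => by rw [← ofReal_norm, Real.norm_eq_abs]
  have htail : ∫⁻ t in Ioi T, ENNReal.ofReal (C * (T / t) ^ p) =
      ENNReal.ofReal (C / (p - 1) * T) := by
    have hcongr : ∀ t ∈ Ioi T, C * (T / t) ^ p = C * T ^ p * t ^ (-p) := by
      intro t ht
      have ht0 : 0 < t := hT.trans ht
      rw [Real.div_rpow hT.le ht0.le, Real.rpow_neg ht0.le]
      ring
    rw [setLIntegral_congr_fun measurableSet_Ioi (fun t ht => by rw [hcongr t ht]),
      ← ofReal_integral_eq_lintegral_ofReal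
        ((integrableOn_Ioi_rpow_of_lt (by linarith) hT).const_mul _)]
    · rw [integral_const_mul, integral_Ioi_rpow_of_lt (by linarith) hT]
      congr 1
      have h1 : T ^ (-p + 1) = T / T ^ p := by
        rw [Real.rpow_add hT, Real.rpow_neg hT.le, Real.rpow_one]
        ring
      have h2 : 0 < T ^ p := Real.rpow_pos_of_pos hT p
      have h3 : -p + 1 ≠ 0 := by linarith
      have h4 : p - 1 ≠ 0 := hp'.ne'
      rw [h1]
      field_simp
      ring
    · filter_upwards [ae_restrict_mem measurableSet_Ioi] with t ht
      have ht0 : 0 < t := hT.trans ht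
      exact mul_nonneg (by positivity) (Real.rpow_nonneg ht0.le _)
  -- Layer cake split at T: the trivial bound below, the tail integral of t^(-p) above.
  rw [hlayer, ← Ioc_union_Ioi_eq_Ioi hT.le,
    lintegral_union measurableSet_Ioi (Ioc_disjoint_Ioi le_rfl)]
  calc _ ≤ (∫⁻ _ in Ioc 0 T, ν univ) +
        ∫⁻ t in Ioi T, ENNReal.ofReal (C * (T / t) ^ p) * ν univ := by
        refine add_le_add (lintegral_mono fun t => measure_mono (μ := ν) (subset_univ _)) ?_
        exact setLIntegral_mono' measurableSet_Ioi fun t ht => h t (hT.trans ht)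
    _ = _ := by
        rw [lintegral_mul_const _ (by fun_prop), htail, setLIntegral_const, Real.volume_Ioc,
          sub_zero, mul_comm (ν univ), ← add_mul, ← ENNReal.ofReal_add hT.le (by positivity)]
        congr 2
        ring

/-- In a weak `L^p` bound, `p > 1`, any constant may be replaced by the mean value. -/
theorem integrable_and_weak_bound_average {X : Type*} [MeasurableSpace X] {ν : Measure X}
    [IsFiniteMeasure ν] [NeZero ν]
    {f : X → ℝ} (hf : AEMeasurable f ν) {p C T c : ℝ} (hp : 1 < p) (hC : 0 ≤ C) (hT : 0 < T)
    (h : ∀ t, 0 < t → ν {y | t < |f y - c|} ≤ ENNReal.ofReal (C * (T / t) ^ p) * ν univ) :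
    Integrable f ν ∧ ∀ t, 0 < t →
      ENNReal.ofReal t * (ν {y | t < |f y - ⨍ z, f z ∂ν|} / ν univ) ^ (1 / p) ≤
        ENNReal.ofReal ((2 * (1 + C / (p - 1)) + 2 * C ^ (1 / p)) * T) := by
  have hp0 : 0 < p := by linarith
  have hp' : 0 < p - 1 := by linarith
  have hν0 : ν univ ≠ 0 := by simpa using NeZero.ne ν
  have hνt : ν univ ≠ ∞ := measure_ne_top _ _
  set K := 1 + C / (p - 1) with hK
  have hK0 : 0 < K := by positivity
  have hL := lintegral_enorm_le_of_weak_bound (hf.sub_const c) hp hC hT h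
  have hint : Integrable (fun y => f y - c) ν :=
    ⟨(hf.sub_const c).aestronglyMeasurable,
      hL.trans_lt (ENNReal.mul_lt_top ENNReal.ofReal_lt_top hνt.lt_top)⟩
  have hfint : Integrable f ν := 
    (hint.add (integrable_const c)).congr (Eventually.of_forall fun y => by simp)
  refine ⟨hfint, ?_⟩
  have hav : |(⨍ z, f z ∂ν) - c| ≤ K * T := by
    have h1 : (⨍ z, f z ∂ν) - c = ⨍ z, (f z - c) ∂ν := by
      rw [average_eq, average_eq, integral_sub hfint (integrable_const c), integral_const]
      have : ν.real univ ≠ 0 := (ENNReal.toReal_pos hν0 hνt).ne'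
      simp only [smul_eq_mul]
      field_simp
    rw [h1, average_eq, smul_eq_mul, abs_mul, abs_of_nonneg (by positivity)]
    have hpos : 0 < ν.real univ := ENNReal.toReal_pos hν0 hνt
    rw [inv_mul_le_iff₀ hpos, ← Real.norm_eq_abs]
    refine (norm_integral_le_lintegral_norm _).trans ?_
    simp only [ofReal_norm]
    refine (ENNReal.toReal_mono (by finiteness) hL).trans_eq ?_
    rw [ENNReal.toReal_mul, ENNReal.toReal_ofReal (by positivity), mul_comm]
    rfl
  intro t ht
  -- For t > 2KT, the shift from c to the mean is at most t/2.
  rcases le_or_gt t (2 * (K * T)) with hle | hlt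
  · calc _ ≤ ENNReal.ofReal (2 * (K * T)) * 1 := by
          gcongr
          refine ENNReal.rpow_le_one (ENNReal.div_le_of_le_mul ?_) (by positivity)
          rw [one_mul]
          exact measure_mono (subset_univ _)
      _ ≤ _ := by
          rw [mul_one]
          refine ENNReal.ofReal_le_ofReal ?_
          have : 0 ≤ 2 * C ^ (1 / p) * T := by positivity
          linarith
  · have hsub : {y | t < |f y - ⨍ z, f z ∂ν|} ⊆ {y | t / 2 < |f y - c|} := by
      intro y hy
      simp only [mem_ofPred_eq] at hy ⊢
      have h1 := abs_sub_le (f y) c (⨍ z, f z ∂ν)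
      rw [abs_sub_comm c] at h1
      linarith
    calc _ ≤ ENNReal.ofReal t * (ENNReal.ofReal (C * (T / (t / 2)) ^ p)) ^ (1 / p) := by
          gcongr
          exact ENNReal.div_le_of_le_mul ((measure_mono hsub).trans (h _ (by positivity)))
      _ = ENNReal.ofReal (2 * C ^ (1 / p) * T) := by
          rw [ENNReal.ofReal_rpow_of_nonneg (by positivity) (by positivity),
            ← ENNReal.ofReal_mul ht.le, Real.mul_rpow hC (by positivity),
            ← Real.rpow_mul (by positivity), mul_one_div_cancel hp0.ne', Real.rpow_one]
          congr 1
          field_simp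
      _ ≤ _ := by
          refine ENNReal.ofReal_le_ofReal ?_
          have : 0 ≤ 2 * K * T := by positivity
          linarith

end WeakType

/-! ### Unpacking the hypotheses on a, and conclusion -/

section Functional

variable {X : Type*} [MetricSpace X] [MeasurableSpace X] {μ : Measure X}

/-- The defining inequality of the `D_p` norm, for one family of disjoint balls. -/
theorem tsum_le_of_DpNorm_mul_le {p : ℝ} (hp : 0 < p) {a : MBall X → ℝ≥0} {B₁ B : MBall X}
    (hB : B.toSet ⊆ B₁.toSet) (hfin : DpNorm μ p a B₁ ≠ ∞)
    (hμ0 : μ B.toSet ≠ 0) (hμt : μ B.toSet ≠ ∞) {T : ℝ} (hT : 0 < T)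
    (h : DpNorm μ p a B₁ * a B ≤ ENNReal.ofReal T)
    {S : Set (MBall X)} (hS : S.PairwiseDisjoint MBall.toSet)
    (hSB : ∀ B' ∈ S, B'.toSet ⊆ B.toSet) :
    ∑' B' : S, (a B' : ℝ≥0∞) ^ p * μ (B' : MBall X).toSet ≤
      ENNReal.ofReal (T ^ p) * μ B.toSet := by
  have h1 : ((∑' B' : S, (a B' : ℝ≥0∞) ^ p * μ (B' : MBall X).toSet) / μ B.toSet) ^ (1 / p) / a B
      ≤ DpNorm μ p a B₁ := by
    refine le_trans ?_ (le_iSup₂_of_le B hB le_rfl)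
    refine ENNReal.div_le_div_right (le_iSup_of_le S ?_) _
    rw [iSup_pos hS, iSup_pos hSB]
  have h2 := ((ENNReal.div_le_iff_le_mul (Or.inr hfin) (Or.inl ENNReal.coe_ne_top)).1 h1).trans h
  rw [one_div, ENNReal.rpow_inv_le_iff hp, ENNReal.ofReal_rpow_of_pos hT,
    ENNReal.div_le_iff_le_mul (Or.inl hμ0) (Or.inl hμt)] at h2
  exact h2

/-- The strict inequality yields an actual c without the infimum being attained. -/
theorem exists_const_of_ballOscillation_lt {ρ : ℝ} (hρ : 0 < ρ) {f : X → ℝ} {B : MBall X}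
    (hμ0 : μ B.toSet ≠ 0) (hμt : μ B.toSet ≠ ∞) {b : ℝ} (hb : 0 < b)
    (h : ballOscillation μ ρ f B < ENNReal.ofReal b) :
    ∃ c : ℝ, ∫⁻ y in B.toSet, ‖f y - c‖ₑ ^ ρ ∂μ ≤ ENNReal.ofReal (b ^ ρ) * μ B.toSet := by
  rw [ballOscillation, one_div, ENNReal.rpow_inv_lt_iff hρ, iInf_lt_iff] at h
  obtain ⟨c, hc⟩ := h
  refine ⟨c, ?_⟩
  rw [setLAverage_eq, ENNReal.ofReal_rpow_of_pos hb] at hc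
  exact (ENNReal.div_le_iff_le_mul (Or.inl hμ0) (Or.inl hμt)).1 hc.le

end Functional

theorem mainTheorem6 {X : Type*} [MetricSpace X] [MeasurableSpace X] [BorelSpace X]
    (μ : Measure X) (hμ : IsDoublingMeasure μ) (p ρ τ η : ℝ) (hp : 1 < p)
    (hρ₀ : 0 < ρ) (hρ₁ : ρ ≤ 1) (hτ : 1 ≤ τ) (hη : 0 < η) :
    ∃ C : ℝ≥0, ∀ (B₀ : MBall X) (f : X → ℝ) (a : MBall X → ℝ≥0),
      AEMeasurable f
        (μ.restrict ((B₀.hat η hη).dilate τ (zero_lt_one.trans_le hτ)).toSet) →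
      (∀ B : MBall X,
        (B.dilate τ (zero_lt_one.trans_le hτ)).toSet ⊆
          ((B₀.hat η hη).dilate τ (zero_lt_one.trans_le hτ)).toSet →
        ballOscillation μ ρ f B ≤ a (B.dilate τ (zero_lt_one.trans_le hτ))) →
      DpNorm μ p a ((B₀.hat η hη).dilate τ (zero_lt_one.trans_le hτ)) < ∞ →
      ∀ B : MBall X,
        ((B.hat η hη).dilate τ (zero_lt_one.trans_le hτ)).toSet ⊆
          ((B₀.hat η hη).dilate τ (zero_lt_one.trans_le hτ)).toSet →
        IntegrableOn f B.toSet μ ∧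
          weakLpNorm μ p (fun x => f x - ⨍ y in B.toSet, f y ∂μ) B ≤
            C * DpNorm μ p a ((B₀.hat η hη).dilate τ (zero_lt_one.trans_le hτ)) *
              a ((B.hat η hη).dilate τ (zero_lt_one.trans_le hτ)) := by
  have hp0 : 0 < p := zero_lt_one.trans hp
  have hτ0 : 0 < τ := zero_lt_one.trans_le hτ
  obtain ⟨C, hC0, hC⟩ := hμ.exists_weak_bound hp0 hρ₀ hρ₁ hτ hη
  set K : ℝ := 2 * (1 + C / (p - 1)) + 2 * C ^ (1 / p) with hK
  have hK0 : 0 < K := by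
    have : 0 < p - 1 := by linarith
    positivity
  refine ⟨K.toNNReal, fun B₀ f a hf hosc hDp B hB => ?_⟩
  set Ω₀ := (B₀.hat η hη).dilate τ hτ0 with hΩ₀
  set Ω := (B.hat η hη).dilate τ hτ0 with hΩ
  have hΩset : Ω.toSet = ball B.center (τ * ((1 + η) * B.radius)) := rfl
  have hBset : B.toSet = ball B.center B.radius := rfl
  have hr := B.radius_pos
  have hBΩ : B.toSet ⊆ Ω₀.toSet := by
    refine Subset.trans ?_ hB
    rw [hΩset, hBset]
    refine ball_subset_ball ?_
    have h1 : (1 + η) * B.radius ≤ τ * ((1 + η) * B.radius) :=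
      le_mul_of_one_le_left (by positivity) hτ
    nlinarith
  let α : X → ℝ → ℝ≥0 := fun x s => if hs : 0 < s then a ⟨x, s, hs⟩ else 0
  -- T must be positive while ‖a‖ a(τB̂) may vanish, so the bound is proved for every larger T,
  -- which is then lowered to the limit.
  have key : ∀ T : ℝ, 0 < T → DpNorm μ p a Ω₀ * a Ω ≤ ENNReal.ofReal T →
      Integrable f (μ.restrict B.toSet) ∧
        weakLpNorm μ p (fun x => f x - ⨍ y in B.toSet, f y ∂μ) B ≤ ENNReal.ofReal (K * T) := by
    intro T hT hDT
    obtain ⟨c, hc⟩ : ∃ c : ℝ, ∀ t, 0 < t → μ {y ∈ B.toSet | t < |hf.mk f y - c|} ≤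
        ENNReal.ofReal (C * (T / t) ^ p) * μ B.toSet := by
      refine hC B.center B.radius (hf.mk f) α T hr hf.measurable_mk hT ?_ ?_
      · intro x s hs hsub b hb
        have hτs : 0 < τ * s := mul_pos hτ0 hs
        have hsub' : ball x (τ * s) ⊆ Ω₀.toSet := hsub.trans hB
        have hb' : a ⟨x, τ * s, hτs⟩ < b := by simpa only [α, dif_pos hτs] using hb
        have hb0 : 0 < b := lt_of_le_of_lt (NNReal.coe_nonneg _) hb'
        obtain ⟨c, hc⟩ := exists_const_of_ballOscillation_lt (μ := μ) (B := ⟨x, s, hs⟩) (f := f) hρ₀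
          (hμ.pos _).ne' (hμ.lt_top _).ne hb0 (by
            refine (hosc ⟨x, s, hs⟩ hsub').trans_lt ?_
            rw [← ENNReal.ofReal_coe_nnreal]
            exact (ENNReal.ofReal_lt_ofReal_iff hb0).2 hb')
        refine ⟨c, le_of_eq_of_le (lintegral_congr_ae ?_) hc⟩
        have hsub2 : ball x s ⊆ Ω₀.toSet :=
          (ball_subset_ball (le_mul_of_one_le_left hs.le hτ)).trans hsub'
        filter_upwards [ae_restrict_of_ae_restrict_of_subset hsub2 hf.ae_eq_mk] with y hy
        rw [hy]
      · intro u s hs hsub hd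
        -- Families indexed by centers become sets of balls; distinct centers give distinct balls.
        let b : u → MBall X := fun x => ⟨x, s x, hs x x.2⟩
        have hbinj : Function.Injective b := fun x y hxy =>
          Subtype.ext (congrArg MBall.center hxy)
        have h := tsum_le_of_DpNorm_mul_le hp0 hB hDp.ne (hμ.pos Ω).ne' (hμ.lt_top Ω).ne hT hDT
          (S := range b) (by
            rintro _ ⟨x, rfl⟩ _ ⟨y, rfl⟩ hxy
            exact hd x.2 y.2 fun h => hxy (by rw [Subtype.ext h]))
          (by
            rintro _ ⟨x, rfl⟩
            exact hsub x x.2)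
        rw [tsum_range (fun B' => (a B' : ℝ≥0∞) ^ p * μ B'.toSet) hbinj] at h
        refine le_of_eq_of_le (tsum_congr fun x => ?_) h
        simp only [α, dif_pos (hs x x.2)]
        rfl
    have hν : (μ.restrict B.toSet) univ = μ B.toSet := Measure.restrict_apply_univ _
    have : IsFiniteMeasure (μ.restrict B.toSet) := ⟨hν ▸ hμ.lt_top B⟩
    have : NeZero (μ.restrict B.toSet) :=
      ⟨fun h0 => (hμ.pos B).ne' (by rw [← hν, h0]; rfl)⟩
    have hmeas : ∀ P : X → Prop, μ.restrict B.toSet {y | P y} = μ {y ∈ B.toSet | P y} :=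
      fun P => by
        rw [Measure.restrict_apply' (show MeasurableSet B.toSet from measurableSet_ball),
          inter_comm]
        rfl
    have haeB : f =ᵐ[μ.restrict B.toSet] hf.mk f :=
      ae_restrict_of_ae_restrict_of_subset hBΩ hf.ae_eq_mk
    obtain ⟨hint, hweak⟩ := integrable_and_weak_bound_average (ν := μ.restrict B.toSet)
      (hf.mono_measure (Measure.restrict_mono_set μ hBΩ)) (c := c) hp hC0 hT (fun t ht => by
        have h1 : ({y | t < |f y - c|} : Set X) =ᵐ[μ.restrict B.toSet]
            {y | t < |hf.mk f y - c|} := by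
          filter_upwards [haeB] with y hy
          exact congrArg (fun z => t < |z - c|) hy
        rw [measure_congr h1, hmeas, hν]
        exact hc t ht)
    refine ⟨hint, iSup₂_le fun t ht => ?_⟩
    have h2 := hweak t ht
    rw [hmeas, hν] at h2
    exact h2
  have hXfin : DpNorm μ p a Ω₀ * a Ω ≠ ∞ := ENNReal.mul_ne_top hDp.ne ENNReal.coe_ne_top
  refine ⟨(key ((DpNorm μ p a Ω₀ * a Ω).toReal + 1) (by positivity) ?_).1, ?_⟩
  · exact (ENNReal.ofReal_toReal hXfin).symm.trans_le (ENNReal.ofReal_le_ofReal (by linarith))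
  · refine ENNReal.le_of_forall_pos_le_add fun ε hε _ => ?_
    have hε' : 0 < (ε : ℝ) / K := div_pos hε hK0
    refine (key ((DpNorm μ p a Ω₀ * a Ω).toReal + ε / K) (by positivity) ?_).2.trans_eq ?_
    · exact (ENNReal.ofReal_toReal hXfin).symm.trans_le (ENNReal.ofReal_le_ofReal (by linarith))
    · rw [mul_add, mul_div_cancel₀ _ hK0.ne', ENNReal.ofReal_add (by positivity) ε.coe_nonneg,
        ENNReal.ofReal_mul hK0.le, ENNReal.ofReal_toReal hXfin, ENNReal.ofReal_coe_nnreal,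
        mul_assoc]
      rfl
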